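/- Let $\mathbb N=\{1,2,3,\dots\}$, let $\log$ be the natural logarithm, and let $\{0,1\}^{\mathbb N}$ carry the $\sigma$-algebra generated by the finite-dimensional cylinders. For a probability measure $\mu$ on $\{0,1\}^{\mathbb N}$ let $p(j)=\mathbb E_{X\sim\mu}[X(j)]$ for $j\in\mathbb N$, and for $n\in\mathbb N$ and $X_1,\dots,X_n$ drawn independently from $\mu$ let $\hat p_n=\frac1n\sum_{i=1}^n X_i$ and $$\Delta_n(\mu)=\mathbb E\,\sup_{j\in\mathbb N}|\hat p_n(j)-p(j)|.$$ Let $\tilde p(j)=\min\{p(j),1-p(j)\}$. If $\tilde p(j)\to0$ as $j\to\infty$, let $q$ be the non-increasing rearrangement of $\tilde p$, that is, let $q(j)$ be the $j$-th largest value of $\tilde p$ counted with multiplicity (equivalently $q(j)=\inf\{t\ge0:\#\{i:\tilde p(i)>t\}<j\}$), and put $$S(\mu)=\sup_{j\in\mathbb N}q(j)\log(j+1)\in[0,\infty],\qquad T(\mu)=\sup_{j\in\mathbb N}\frac{\log(j+1)}{\log(1/q(j))}\in[0,\infty],$$ where a term of the second supremum with $q(j)=0$ is read as $0$. If $\tilde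 p(j)\not\to0$, put $S(\mu)=T(\mu)=\infty$. **Theorem.** There is an absolute constant $c>0$ such that for every probability measure $\mu$ on $\{0,1\}^{\mathbb N}$ (not necessarily a product measure) with $T(\mu)<\infty$ and every integer $n\ge \mathrm e^3$, $$\Delta_n(\mu)\le c\left(\sqrt{\frac{S(\mu)}{n}}+\frac{T(\mu)\log n}{n}\right).$$ -/

import Mathlib

open MeasureTheory Filter Topology
open scoped ENNReal

namespace LocalGC

noncomputable section

/-! The cube `{0,1}^ℕ` is `ℕ → Bool` with its product σ-algebra. Coordinates are numbered from `0`,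
so index `j` here is the usual index `j + 1`, and the weight of index `j` is `log (j + 2)`. -/

/-- The `j`-th coordinate of a point of `{0,1}^ℕ`, as a real number. -/
def coord (x : ℕ → Bool) (j : ℕ) : ℝ := if x j then 1 else 0

/-- The mean vector `p(j) = E_{X ∼ μ} [X(j)]`. -/
def mean (μ : Measure (ℕ → Bool)) (j : ℕ) : ℝ := ∫ x, coord x j ∂μ

/-- The empirical mean `n⁻¹ ∑ᵢ Xᵢ(j)` of a sample of size `n`. -/
def empMean {n : ℕ} (X : Fin n → ℕ → Bool) (j : ℕ) : ℝ := (∑ i, coord (X i) j) / n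

/-- The expected maximal deviation `Δ_n(μ) = E sup_j |p̂_n(j) - p(j)|`, where the sample
`X 0, …, X (n - 1)` is iid from `μ`. -/
def Delta (n : ℕ) (μ : Measure (ℕ → Bool)) : ℝ≥0∞ :=
  ∫⁻ X : Fin n → ℕ → Bool, ⨆ j : ℕ, ENNReal.ofReal |empMean X j - mean μ j|
    ∂(Measure.pi fun _ => μ)

/-- The non-increasing rearrangement of a nonnegative sequence tending to `0`: index `j` (from `0`)
carries the `(j + 1)`-st largest value, counted with multiplicity. -/
def decr (p : ℕ → ℝ) (j : ℕ) : ℝ := sInf {t : ℝ | 0 ≤ t ∧ {i : ℕ | t < p i}.encard ≤ j}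

/-- `S(p) = sup_j p(j) log (j + 1)` (indices from `1`), with values in `[0, ∞]`. -/
def seqS (p : ℕ → ℝ) : ℝ≥0∞ := ⨆ j : ℕ, ENNReal.ofReal (p j * Real.log (j + 2))

/-- `T(p) = sup_j log (j + 1) / log (1 / p(j))` (indices from `1`), with values in `[0, ∞]`.
A term with `p(j) = 0` is `0`, as it should be (`log (1 / 0)` is read as `∞`); it is used only for
sequences in `[0, 1/2]`, so all other denominators are positive. -/
def seqT (p : ℕ → ℝ) : ℝ≥0∞ :=
  ⨆ j : ℕ, ENNReal.ofReal (if p j = 0 then 0 else Real.log (j + 2) / Real.log (1 / p j))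

/-- `p̃(j) = min {p(j), 1 - p(j)}`. -/
def meanTilde (μ : Measure (ℕ → Bool)) (j : ℕ) : ℝ := min (mean μ j) (1 - mean μ j)

open Classical in
/-- `S(μ)`, the value of `S` at the non-increasing rearrangement of `p̃`; `∞` unless `p̃ → 0`. -/
def S (μ : Measure (ℕ → Bool)) : ℝ≥0∞ :=
  if Tendsto (meanTilde μ) atTop (𝓝 0) then seqS (decr (meanTilde μ)) else ∞

open Classical in
/-- `T(μ)`, the value of `T` at the non-increasing rearrangement of `p̃`; `∞` unless `p̃ → 0`. -/
def T (μ : Measure (ℕ → Bool)) : ℝ≥0∞ :=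
  if Tendsto (meanTilde μ) atTop (𝓝 0) then seqT (decr (meanTilde μ)) else ∞

end

end LocalGC

namespace LocalGC

/-! For any level `a`, the supremum of the deviations is at most `a` plus the sum of their positive
excesses over `a`, so a union bound suffices and dependence between coordinates plays no role. A
Chernoff estimate bounds each expected excess through the Bernoulli moment generating function, with
a free exponent `l` for each coordinate.

Let `R = √(s/n) + t log n / n`, let `a` be of order `R`, and let a coordinate have position `k` in
the sorted order and `L = log (k + 2)`. Then `p̃ L ≤ s` and `L ≤ t log (1/p̃)`, and these alone
allow an `l` making the expected excess at most `8 R exp (-2 L)` (`exists_exponent`). As `exp (-2 L)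
= (k + 2)⁻²` is summable and `rank` is injective where `p̃ > 0`, the total is `O(R)`
(`Delta_le_of_decr`). -/

lemma measurable_coord (j : ℕ) : Measurable fun x : ℕ → Bool => coord x j :=
  (measurable_of_countable fun b : Bool => if b then (1 : ℝ) else 0).comp (measurable_pi_apply j)

lemma coord_eq_zero_or_one (x : ℕ → Bool) (j : ℕ) : coord x j = 0 ∨ coord x j = 1 := by
  unfold coord
  split_ifs <;> simp

lemma integrable_coord (μ : Measure (ℕ → Bool)) [IsProbabilityMeasure μ] (j : ℕ) :
    Integrable (fun x => coord x j) μ := by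
  refine Integrable.of_bound (measurable_coord j).aestronglyMeasurable 1 (ae_of_all _ fun x => ?_)
  rcases coord_eq_zero_or_one x j with h | h <;> simp [h]

lemma mean_nonneg (μ : Measure (ℕ → Bool)) (j : ℕ) : 0 ≤ mean μ j :=
  integral_nonneg fun x => by rcases coord_eq_zero_or_one x j with h | h <;> simp [h]

lemma mean_le_one (μ : Measure (ℕ → Bool)) [IsProbabilityMeasure μ] (j : ℕ) : mean μ j ≤ 1 := by
  have h : mean μ j ≤ ∫ _, (1 : ℝ) ∂μ :=
    integral_mono (integrable_coord μ j) (integrable_const 1) fun x => by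
      rcases coord_eq_zero_or_one x j with h | h <;> simp [h]
  simpa using h

lemma meanTilde_nonneg (μ : Measure (ℕ → Bool)) [IsProbabilityMeasure μ] (j : ℕ) :
    0 ≤ meanTilde μ j :=
  le_min (mean_nonneg μ j) (sub_nonneg.2 (mean_le_one μ j))

lemma meanTilde_le_half (μ : Measure (ℕ → Bool)) (j : ℕ) : meanTilde μ j ≤ 1 / 2 := by
  unfold meanTilde
  rcases le_total (mean μ j) (1 / 2) with h | h
  · exact (min_le_left _ _).trans h
  · exact (min_le_right _ _).trans (by linarith)

/-! ### The moment generating function -/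

lemma exp_mul_coord_sub (x : ℕ → Bool) (j : ℕ) (l m : ℝ) :
    Real.exp (l * (coord x j - m)) =
      Real.exp (-l * m) * (1 + coord x j * (Real.exp l - 1)) := by
  rcases coord_eq_zero_or_one x j with h | h
  · simp [h]
  · rw [h, one_mul, add_sub_cancel, ← Real.exp_add]
    ring_nf

lemma integrable_exp_mul_coord_sub (μ : Measure (ℕ → Bool)) [IsProbabilityMeasure μ] (j : ℕ)
    (l m : ℝ) : Integrable (fun x => Real.exp (l * (coord x j - m))) μ := by
  simp_rw [exp_mul_coord_sub]
  exact ((integrable_const 1).add ((integrable_coord μ j).mul_const _)).const_mul _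

lemma integral_exp_mul_coord_sub (μ : Measure (ℕ → Bool)) [IsProbabilityMeasure μ] (j : ℕ)
    (l : ℝ) : ∫ x, Real.exp (l * (coord x j - mean μ j)) ∂μ =
      Real.exp (-l * mean μ j) * (1 + mean μ j * (Real.exp l - 1)) := by
  simp_rw [exp_mul_coord_sub]
  rw [integral_const_mul, integral_add (integrable_const 1) ((integrable_coord μ j).mul_const _),
    integral_mul_const]
  simp [mean]

/-- The Bennett function at `-l` is at most its value at `l`. -/
lemma exp_neg_sub_one_add_le {l : ℝ} (hl : 0 ≤ l) :
    Real.exp (-l) - 1 + l ≤ Real.exp l - 1 - l := by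
  have h := Real.self_le_sinh_iff.2 hl
  rw [Real.sinh_eq] at h
  linarith

lemma bernoulli_mgf_le_left (m l : ℝ) :
    Real.exp (-l * m) * (1 + m * (Real.exp l - 1)) ≤ Real.exp (m * (Real.exp l - 1 - l)) := by
  calc Real.exp (-l * m) * (1 + m * (Real.exp l - 1))
      ≤ Real.exp (-l * m) * Real.exp (m * (Real.exp l - 1)) := by
        gcongr
        linarith [Real.add_one_le_exp (m * (Real.exp l - 1))]
    _ = _ := by rw [← Real.exp_add]; ring_nf

/-- Symmetry under exchanging 0 and 1, which replaces `(m, l)` by `(1 - m, -l)`. With the previous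
bound it brings in the smaller of `m` and `1 - m`. -/
lemma bernoulli_mgf_le_right (m l : ℝ) :
    Real.exp (-l * m) * (1 + m * (Real.exp l - 1)) ≤
      Real.exp ((1 - m) * (Real.exp (-l) - 1 + l)) := by
  have h : Real.exp (-l * m) * (1 + m * (Real.exp l - 1)) =
      Real.exp (-(-l) * (1 - m)) * (1 + (1 - m) * (Real.exp (-l) - 1)) := by
    have h1 : Real.exp (-(-l) * (1 - m)) = Real.exp (-l * m) * Real.exp l := by
      rw [← Real.exp_add]; ring_nf
    have h2 : Real.exp l * Real.exp (-l) = 1 := by rw [← Real.exp_add]; simp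
    rw [h1]
    linear_combination (-(Real.exp (-l * m) * (1 - m))) * h2
  rw [h]
  simpa using bernoulli_mgf_le_left (1 - m) (-l)

lemma integral_exp_mul_coord_sub_le (μ : Measure (ℕ → Bool)) [IsProbabilityMeasure μ] (j : ℕ)
    (l : ℝ) : ∫ x, Real.exp (l * (coord x j - mean μ j)) ∂μ ≤
      Real.exp (meanTilde μ j * (Real.exp |l| - 1 - |l|)) := by
  rw [integral_exp_mul_coord_sub]
  have h1 := bernoulli_mgf_le_left (mean μ j) l
  have h2 := bernoulli_mgf_le_right (mean μ j) l
  have h0 := mean_nonneg μ j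
  have h3 := mean_le_one μ j
  have h4 := exp_neg_sub_one_add_le (abs_nonneg l)
  have key : Real.exp l - 1 - l ≤ Real.exp |l| - 1 - |l| ∧
      Real.exp (-l) - 1 + l ≤ Real.exp |l| - 1 - |l| := by
    rcases abs_cases l with ⟨h, -⟩ | ⟨h, -⟩ <;> rw [h] at h4 ⊢
    · exact ⟨le_rfl, h4⟩
    · rw [neg_neg] at h4
      exact ⟨by linarith, by linarith⟩
  unfold meanTilde
  rcases min_choice (mean μ j) (1 - mean μ j) with h | h <;> rw [h]
  · exact h1.trans (Real.exp_le_exp.2 (mul_le_mul_of_nonneg_left key.1 h0))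
  · exact h2.trans (Real.exp_le_exp.2 (mul_le_mul_of_nonneg_left key.2 (by linarith)))

/-! ### Exponential moments and expected excess of the empirical mean -/

variable {n : ℕ}

lemma measurable_empMean (j : ℕ) :
    Measurable fun X : Fin n → ℕ → Bool => empMean X j :=
  (Finset.measurable_sum _ fun i _ => (measurable_coord j).comp (measurable_pi_apply i)).div_const _

lemma exp_mul_empMean_sub (hn : 0 < n) (X : Fin n → ℕ → Bool) (j : ℕ) (l m : ℝ) :
    Real.exp (n * (l * (empMean X j - m))) = ∏ i, Real.exp (l * (coord (X i) j - m)) := by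
  rw [← Real.exp_sum, ← Finset.mul_sum, Finset.sum_sub_distrib]
  have : (n : ℝ) ≠ 0 := by positivity
  simp only [empMean, Finset.sum_const, Finset.card_univ, Fintype.card_fin, nsmul_eq_mul]
  congr 1
  field_simp

lemma integrable_exp_mul_empMean_sub (μ : Measure (ℕ → Bool)) [IsProbabilityMeasure μ]
    (hn : 0 < n) (j : ℕ) (l m : ℝ) :
    Integrable (fun X : Fin n → ℕ → Bool => Real.exp (n * (l * (empMean X j - m))))
      (Measure.pi fun _ => μ) := by
  simp_rw [exp_mul_empMean_sub hn]
  exact Integrable.fintype_prod fun _ => integrable_exp_mul_coord_sub μ j l m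

lemma integral_exp_mul_empMean_sub_le (μ : Measure (ℕ → Bool)) [IsProbabilityMeasure μ]
    (hn : 0 < n) (j : ℕ) (l : ℝ) :
    ∫ X : Fin n → ℕ → Bool, Real.exp (n * (l * (empMean X j - mean μ j)))
      ∂(Measure.pi fun _ => μ) ≤
        Real.exp (n * (meanTilde μ j * (Real.exp |l| - 1 - |l|))) := by
  simp_rw [exp_mul_empMean_sub hn]
  rw [integral_fintype_prod_eq_pow (fun x => Real.exp (l * (coord x j - mean μ j))),
    Fintype.card_fin, Real.exp_nat_mul]
  exact pow_le_pow_left₀ (integral_nonneg fun _ => (Real.exp_pos _).le)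
    (integral_exp_mul_coord_sub_le μ j l) n

/-- Bernstein-type bound for the expected excess of one coordinate over a level `a`. -/
lemma lintegral_excess_le (μ : Measure (ℕ → Bool)) [IsProbabilityMeasure μ]
    (hn : 0 < n) (j : ℕ) {l : ℝ} (hl : 0 < l) (a : ℝ) :
    ∫⁻ X : Fin n → ℕ → Bool, ENNReal.ofReal (|empMean X j - mean μ j| - a)
      ∂(Measure.pi fun _ => μ) ≤
        ENNReal.ofReal (2 / (n * l) *
          Real.exp (n * (meanTilde μ j * (Real.exp l - 1 - l)) - n * (l * a))) := by
  have hn' : (0 : ℝ) < n := by exact_mod_cast hn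
  set c : ℝ := 1 / (n * l) * Real.exp (-(n * (l * a))) with hc
  have hc0 : 0 ≤ c := by positivity
  set G : (Fin n → ℕ → Bool) → ℝ := fun X =>
    c * (Real.exp (n * (l * (empMean X j - mean μ j))) +
      Real.exp (n * (-l * (empMean X j - mean μ j)))) with hG
  have hi1 := integrable_exp_mul_empMean_sub μ hn j l (mean μ j)
  have hi2 := integrable_exp_mul_empMean_sub μ hn j (-l) (mean μ j)
  have hpt : ∀ X, |empMean X j - mean μ j| - a ≤ G X := by
    intro X
    set y := empMean X j - mean μ j
    -- The inequality `x ≤ exp x` dominates the excess directly, with no tail integration; the two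
    -- signs of `y` account for the factor 2.
    have h1 : n * (l * (|y| - a)) ≤ Real.exp (n * (l * (|y| - a))) := by
      linarith [Real.add_one_le_exp (n * (l * (|y| - a)))]
    have h2 : Real.exp (n * (l * |y|)) ≤ Real.exp (n * (l * y)) + Real.exp (n * (-l * y)) := by
      rcases abs_cases y with ⟨h, -⟩ | ⟨h, -⟩ <;> rw [h]
      · linarith [Real.exp_pos (n * (-l * y))]
      · rw [mul_neg, ← neg_mul]
        linarith [Real.exp_pos (n * (l * y))]
    calc |y| - a = 1 / (n * l) * (n * (l * (|y| - a))) := by field_simp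
      _ ≤ 1 / (n * l) * Real.exp (n * (l * (|y| - a))) := by gcongr
      _ = c * Real.exp (n * (l * |y|)) := by
        rw [hc, mul_assoc, ← Real.exp_add]; ring_nf
      _ ≤ G X := mul_le_mul_of_nonneg_left h2 hc0
  calc _ ≤ ∫⁻ X, ENNReal.ofReal (G X) ∂(Measure.pi fun _ => μ) :=
        lintegral_mono fun X => ENNReal.ofReal_le_ofReal (hpt X)
    _ = ENNReal.ofReal (∫ X, G X ∂(Measure.pi fun _ => μ)) :=
        (ofReal_integral_eq_lintegral_ofReal ((hi1.add hi2).const_mul c)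
          (ae_of_all _ fun X => mul_nonneg hc0
            (add_pos (Real.exp_pos _) (Real.exp_pos _)).le)).symm
    _ ≤ _ := by
        apply ENNReal.ofReal_le_ofReal
        rw [hG, integral_const_mul, integral_add hi1 hi2]
        have h1 := integral_exp_mul_empMean_sub_le μ hn j l
        have h2 := integral_exp_mul_empMean_sub_le μ hn j (-l)
        rw [abs_neg] at h2
        rw [abs_of_pos hl] at h1 h2
        calc _ ≤ c * (2 * Real.exp (n * (meanTilde μ j * (Real.exp l - 1 - l)))) := by
              apply mul_le_mul_of_nonneg_left _ hc0
              linarith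
          _ = _ := by rw [hc, sub_eq_add_neg _ ((n : ℝ) * (l * a)), Real.exp_add]; ring

/-! ### The choice of the exponent -/

lemma two_div_mul_exp_le {n l R p a L : ℝ} (hn : 0 < n) (hl : 0 < l)
    (hR : 1 ≤ 4 * R * (n * l))
    (he : n * (p * (Real.exp l - 1 - l)) - n * (l * a) ≤ -2 * L) :
    2 / (n * l) * Real.exp (n * (p * (Real.exp l - 1 - l)) - n * (l * a)) ≤
      8 * R * Real.exp (-2 * L) := by
  have h : 2 / (n * l) ≤ 8 * R := by
    rw [div_le_iff₀ (by positivity)]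
    linarith
  exact mul_le_mul h (Real.exp_le_exp.2 he) (Real.exp_pos _).le ((by positivity : (0:ℝ) ≤ _).trans h)

/-- Three regimes. If `L ≤ n p`, deviations are sub-Gaussian and the term in `s` suffices. If `L > n
p`, the term in `t` does the work: `l = 1` is enough when `p ≥ n⁻²`, and smaller `p` needs an `l`
growing like `log (1/p)`. -/
lemma exists_exponent {n p L s t : ℝ} (hn : Real.exp 3 ≤ n) (hp : 0 < p) (hp2 : p ≤ 1 / 2)
    (hL : Real.log 2 ≤ L) (hs : p * L ≤ s) (ht : L ≤ t * Real.log (1 / p)) :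
    ∃ l, 0 < l ∧ 2 / (n * l) * Real.exp (n * (p * (Real.exp l - 1 - l)) -
        n * (l * (4 * √(s / n) + 6 * (t * Real.log n / n)))) ≤
      8 * (√(s / n) + t * Real.log n / n) * Real.exp (-2 * L) := by
  have hn0 : 0 < n := (Real.exp_pos 3).trans_le hn
  have hlog : 3 ≤ Real.log n := (Real.le_log_iff_exp_le hn0).2 hn
  have hL0 : 1 / 2 ≤ L := by linarith [Real.log_two_gt_d9]
  have hlp : 0 < Real.log (1 / p) := Real.log_pos (by rw [lt_div_iff₀ hp]; linarith)
  have ht0 : 0 < t := by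
    by_contra! h
    nlinarith
  set A := √(s / n) with hA
  have hA0 : 0 ≤ A := Real.sqrt_nonneg _
  set B := t * Real.log n / n with hB
  have hB0 : 0 ≤ B := by positivity
  have hnB : n * B = t * Real.log n := by rw [hB]; field_simp
  by_cases h1 : L ≤ n * p
  · have hl0 : 0 < √(L / (n * p)) := Real.sqrt_pos.2 (by positivity)
    -- Makes the quadratic term `n p l²` equal to `L`, while `p L ≤ s` gives `n l A ≥ L`.
    set l := √(L / (n * p)) with hl
    have hsq : n * p * l ^ 2 = L := by
      rw [hl, Real.sq_sqrt (by positivity)]; field_simp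
    have hl1 : l ≤ 1 := by
      rw [hl, Real.sqrt_le_one]
      exact (div_le_one (by positivity)).2 h1
    have hlA : L ≤ n * (l * A) := by
      have : L / n ≤ l * A := by
        rw [hl, hA, ← Real.sqrt_mul (by positivity)]
        apply Real.le_sqrt_of_sq_le
        rw [div_pow, div_mul_div_comm, div_le_div_iff₀ (by positivity) (by positivity)]
        have := mul_le_mul_of_nonneg_left hs (by positivity : 0 ≤ L * n ^ 2)
        nlinarith
      rw [div_le_iff₀ hn0] at this
      linarith
    have hexp : Real.exp l - 1 - l ≤ l ^ 2 := by
      have := Real.abs_exp_sub_one_sub_id_le (x := l) (by rwa [abs_of_pos hl0])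
      exact (le_abs_self _).trans this
    have hlB : 0 ≤ n * (l * B) := by positivity
    refine ⟨l, hl0, two_div_mul_exp_le hn0 hl0 ?_ ?_⟩
    · linarith
    · have : n * (p * (Real.exp l - 1 - l)) ≤ n * (p * l ^ 2) := by gcongr
      linarith
  push Not at h1
  by_cases h2 : Real.log (1 / p) ≤ 2 * Real.log n
  · have hLn : L ≤ 2 * (n * B) := by
      rw [hnB]
      have := mul_le_mul_of_nonneg_left h2 ht0.le
      linarith
    have hnA : 0 ≤ n * A := by positivity
    refine ⟨1, one_pos, two_div_mul_exp_le hn0 one_pos ?_ ?_⟩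
    · linarith
    · have : n * (p * (Real.exp 1 - 1 - 1)) ≤ n * (p * 1) := by
        gcongr
        linarith [Real.exp_one_lt_d9]
      linarith
  · push Not at h2
    -- Here `exp l = p^(-1/2)`, so `n p exp l = n √p ≤ 1`, and `t l ≥ L / 2`.
    set l := Real.log (1 / p) / 2 with hl
    have hl0 : 0 < l := by positivity
    have hexp : n * (p * Real.exp l) ≤ 1 := by
      have hp' : p = Real.exp (-(2 * l)) := by
        rw [hl, one_div, Real.log_inv, mul_div_cancel₀ _ two_ne_zero, neg_neg, Real.exp_log hp]
      have hn' : n = Real.exp (Real.log n) := (Real.exp_log hn0).symm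
      rw [hn', hp', ← Real.exp_add, ← Real.exp_add, Real.exp_le_one_iff]
      linarith
    have hlB : 3 * (L / 2) ≤ n * (l * B) := by
      have e : n * (l * B) = Real.log n * (t * l) := by
        linear_combination l * hnB
      rw [e]
      exact mul_le_mul hlog (by rw [hl]; linarith) (by positivity) (by linarith)
    have hlA : 0 ≤ n * (l * A) := by positivity
    refine ⟨l, hl0, two_div_mul_exp_le hn0 hl0 ?_ ?_⟩
    · linarith
    · have : 0 ≤ n * (p * (1 + l)) := by positivity
      linarith

/-! ### The rearrangement -/

/-- The number of indices that come before `j` when `p` is sorted in non-increasing order, ties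
being broken by the index. -/
noncomputable def rank (p : ℕ → ℝ) (j : ℕ) : ℕ := {i | p j < p i ∨ p i = p j ∧ i < j}.ncard

lemma finite_setOf_le {p : ℕ → ℝ} (hp : Tendsto p atTop (𝓝 0)) {t : ℝ} (ht : 0 < t) :
    {i | t ≤ p i}.Finite := by
  have h := hp.eventually (gt_mem_nhds ht)
  rw [← Nat.cofinite_eq_atTop, eventually_cofinite] at h
  simpa using h

lemma rank_set_subset (p : ℕ → ℝ) (j : ℕ) :
    {i | p j < p i ∨ p i = p j ∧ i < j} ⊆ {i | p j ≤ p i} := by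
  rintro i (h | h)
  · exact h.le
  · exact h.1.ge

/-- Positivity of `p j` makes the set counted by `rank p j` finite; `ncard` of an infinite set would
be 0. -/
lemma rank_lt_rank {p : ℕ → ℝ} (hp : Tendsto p atTop (𝓝 0)) {i j : ℕ} (hj : 0 < p j)
    (h : p j < p i ∨ p i = p j ∧ i < j) : rank p i < rank p j := by
  refine Set.ncard_lt_ncard ⟨?_, fun hs => ?_⟩
    ((finite_setOf_le hp hj).subset (rank_set_subset p j))
  · rintro k (hk | hk)
    · left
      rcases h with h | h <;> linarith
    · rcases h with h | h
      · left; linarith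
      · right; exact ⟨hk.1.trans h.1, hk.2.trans h.2⟩
  · simpa using hs h

lemma rank_injOn {p : ℕ → ℝ} (hp : Tendsto p atTop (𝓝 0)) : Set.InjOn (rank p) {j | 0 < p j} := by
  intro i hi j hj h
  by_contra hne
  rcases lt_trichotomy (p i) (p j) with h1 | h1 | h1
  · exact (rank_lt_rank hp hi (Or.inl h1)).ne' h
  · rcases lt_or_gt_of_ne hne with h2 | h2
    · exact (rank_lt_rank hp hj (Or.inr ⟨h1, h2⟩)).ne h
    · exact (rank_lt_rank hp hi (Or.inr ⟨h1.symm, h2⟩)).ne' h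
  · exact (rank_lt_rank hp hj (Or.inl h1)).ne h

/-- Below `p j`, every level is exceeded by `j` and by all its predecessors, one index too many for
`decr`. The bound `M` keeps the infimum from being over the empty set. -/
lemma le_decr_rank {p : ℕ → ℝ} (hp : Tendsto p atTop (𝓝 0)) {M : ℝ} (hM0 : 0 ≤ M)
    (hM : ∀ i, p i ≤ M) {j : ℕ} (hj : 0 < p j) : p j ≤ decr p (rank p j) := by
  refine le_csInf ⟨M, hM0, ?_⟩ ?_
  · have : {i | M < p i} = ∅ := by
      ext i
      simpa using hM i
    simp [this]
  · rintro t ⟨-, ht⟩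
    by_contra! hlt
    set R := {i | p j < p i ∨ p i = p j ∧ i < j} with hR
    have hfin : R.Finite := (finite_setOf_le hp hj).subset (rank_set_subset p j)
    have hsub : insert j R ⊆ {i | t < p i} := by
      rintro i (rfl | hi)
      · exact hlt
      · exact hlt.trans_le (rank_set_subset p j hi)
    have hjR : j ∉ R := by simp [hR]
    have h1 := (Set.encard_le_encard hsub).trans ht
    rw [Set.encard_insert_of_notMem hjR, ← hfin.cast_ncard_eq] at h1
    have h2 : R.ncard + 1 ≤ R.ncard := by exact_mod_cast h1
    omega

lemma decr_le {p : ℕ → ℝ} {M : ℝ} (hM0 : 0 ≤ M) (hM : ∀ i, p i ≤ M) (j : ℕ) : decr p j ≤ M := by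
  refine csInf_le ⟨0, fun t ht => ht.1⟩ ⟨hM0, ?_⟩
  have : {i | M < p i} = ∅ := by
    ext i
    simpa using hM i
  simp [this]

lemma mul_log_le_of_seqS {q : ℕ → ℝ} {s : ℝ} (hs : 0 ≤ s) (h : seqS q ≤ ENNReal.ofReal s) (k : ℕ) :
    q k * Real.log (k + 2) ≤ s :=
  (ENNReal.ofReal_le_ofReal_iff hs).1
    ((le_iSup (fun j : ℕ => ENNReal.ofReal (q j * Real.log (j + 2))) k).trans h)

lemma log_le_of_seqT {q : ℕ → ℝ} {t : ℝ} (ht : 0 ≤ t) (h : seqT q ≤ ENNReal.ofReal t) {k : ℕ}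
    (hq : 0 < q k) (hq1 : q k < 1) : Real.log (k + 2) ≤ t * Real.log (1 / q k) := by
  have h1 := (ENNReal.ofReal_le_ofReal_iff ht).1
    ((le_iSup (fun j : ℕ => ENNReal.ofReal
      (if q j = 0 then 0 else Real.log (j + 2) / Real.log (1 / q j))) k).trans h)
  rw [if_neg hq.ne'] at h1
  exact (div_le_iff₀ (Real.log_pos (by rwa [lt_div_iff₀ hq, one_mul]))).1 h1

/-! ### Summation -/

lemma tsum_exp_log_ne_top :
    ∑' k : ℕ, ENNReal.ofReal (Real.exp (-2 * Real.log ((k : ℝ) + 2))) ≠ ∞ := by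
  have hs : Summable fun k : ℕ => Real.exp (-2 * Real.log ((k : ℝ) + 2)) := by
    have h := (summable_nat_add_iff 2).2 (Real.summable_one_div_nat_pow.2 one_lt_two)
    refine h.congr fun k => ?_
    have hk : (0 : ℝ) < (k : ℝ) + 2 := by positivity
    rw [neg_mul, Real.exp_neg, mul_comm, Real.exp_mul, Real.exp_log hk]
    push_cast
    norm_num
  exact hs.tsum_ofReal_ne_top

/-- A coordinate with `p̃ = 0` does not fluctuate. -/
lemma lintegral_excess_eq_zero (μ : Measure (ℕ → Bool)) [IsProbabilityMeasure μ]
    (hn : 0 < n) {j : ℕ} (hj : meanTilde μ j = 0) {a : ℝ} (ha : 0 ≤ a) :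
    ∫⁻ X : Fin n → ℕ → Bool, ENNReal.ofReal (|empMean X j - mean μ j| - a)
      ∂(Measure.pi fun _ => μ) = 0 := by
  have hn' : (0 : ℝ) < n := by exact_mod_cast hn
  refine le_antisymm (ENNReal.le_of_forall_pos_le_add fun e he _ => ?_) zero_le
  have he' : (0 : ℝ) < e := he
  -- With `p̃ = 0` the exponent is nonpositive for every `l`, so `l` can be taken large enough to
  -- make the prefactor equal `e`.
  refine (lintegral_excess_le μ hn j (l := 2 / (n * e)) (by positivity) a).trans ?_
  rw [zero_add, ← ENNReal.ofReal_coe_nnreal]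
  apply ENNReal.ofReal_le_ofReal
  rw [hj]
  have h1 : 2 / (n * (2 / (n * (e : ℝ)))) = e := by field_simp
  have h2 : Real.exp (n * (0 * (Real.exp (2 / (n * e)) - 1 - 2 / (n * e))) -
      n * (2 / (n * e) * a)) ≤ 1 := by
    rw [Real.exp_le_one_iff]
    have : 0 ≤ n * (2 / (n * e) * a) := by positivity
    linarith
  rw [h1]
  exact mul_le_of_le_one_right he'.le h2

lemma Delta_le_add_tsum (μ : Measure (ℕ → Bool)) [IsProbabilityMeasure μ] (a : ℝ) :
    Delta n μ ≤ ENNReal.ofReal a +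
      ∑' j : ℕ, ∫⁻ X : Fin n → ℕ → Bool, ENNReal.ofReal (|empMean X j - mean μ j| - a)
        ∂(Measure.pi fun _ => μ) := by
  have hm : ∀ j : ℕ, Measurable fun X : Fin n → ℕ → Bool =>
      ENNReal.ofReal (|empMean X j - mean μ j| - a) := fun j =>
    (((measurable_empMean j).sub_const _).norm.sub_const a).ennreal_ofReal
  rw [← lintegral_tsum fun j => (hm j).aemeasurable]
  calc Delta n μ ≤ ∫⁻ X : Fin n → ℕ → Bool, (ENNReal.ofReal a +
        ∑' j : ℕ, ENNReal.ofReal (|empMean X j - mean μ j| - a)) ∂(Measure.pi fun _ => μ) := by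
        refine lintegral_mono fun X => iSup_le fun j => ?_
        calc ENNReal.ofReal |empMean X j - mean μ j|
            = ENNReal.ofReal (a + (|empMean X j - mean μ j| - a)) := by ring_nf
          _ ≤ ENNReal.ofReal a + ENNReal.ofReal (|empMean X j - mean μ j| - a) :=
              ENNReal.ofReal_add_le
          _ ≤ _ := by
              gcongr
              exact ENNReal.le_tsum (f := fun j => ENNReal.ofReal (|empMean X j - mean μ j| - a)) j
    _ = _ := by rw [lintegral_add_left measurable_const]; simp

lemma Delta_le_of_decr (μ : Measure (ℕ → Bool)) [IsProbabilityMeasure μ]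
    (hμ : Tendsto (meanTilde μ) atTop (𝓝 0)) (hn : Real.exp 3 ≤ (n : ℝ)) {s t : ℝ}
    (hs0 : 0 ≤ s) (ht0 : 0 ≤ t) (hs : seqS (decr (meanTilde μ)) ≤ ENNReal.ofReal s)
    (ht : seqT (decr (meanTilde μ)) ≤ ENNReal.ofReal t) :
    Delta n μ ≤
      ENNReal.ofReal (4 * √(s / n) + 6 * (t * Real.log n / n)) +
        ENNReal.ofReal (8 * (√(s / n) + t * Real.log n / n)) *
          ∑' k : ℕ, ENNReal.ofReal (Real.exp (-2 * Real.log ((k : ℝ) + 2))) := by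
  have hn0 : (0 : ℝ) < n := (Real.exp_pos 3).trans_le hn
  have hn' : 0 < n := by exact_mod_cast hn0
  have hlog : 3 ≤ Real.log n := (Real.le_log_iff_exp_le hn0).2 hn
  set a := 4 * √(s / n) + 6 * (t * Real.log n / n) with ha
  have ha0 : 0 ≤ a := by positivity
  have hR0 : 0 ≤ 8 * (√(s / n) + t * Real.log n / n) := by positivity
  refine (Delta_le_add_tsum μ a).trans (add_le_add_right ?_ _)
  set F : ℕ → ℝ≥0∞ := fun j => ∫⁻ X : Fin n → ℕ → Bool,
    ENNReal.ofReal (|empMean X j - mean μ j| - a) ∂(Measure.pi fun _ => μ) with hF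
  set P : Set ℕ := {j | 0 < meanTilde μ j} with hP
  -- Coordinates with `p̃ = 0` may be infinitely many and `rank` need not separate them, but they
  -- contribute nothing.
  have hsupp : Function.support F ⊆ P := by
    intro j hj
    refine lt_of_le_of_ne (meanTilde_nonneg μ j) fun h => hj ?_
    exact lintegral_excess_eq_zero μ hn' h.symm ha0
  rw [← tsum_subtype_eq_of_support_subset hsupp, ← ENNReal.tsum_mul_left]
  refine le_trans (ENNReal.tsum_le_tsum fun j : P => ?_)
    (ENNReal.tsum_comp_le_tsum_of_injective (rank_injOn hμ).injective _)
  obtain ⟨j, hj⟩ := j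
  have hj' : 0 < meanTilde μ j := hj
  set k := rank (meanTilde μ) j with hk
  have hqj : meanTilde μ j ≤ decr (meanTilde μ) k :=
    le_decr_rank hμ (by norm_num) (meanTilde_le_half μ) hj'
  have hq2 : decr (meanTilde μ) k ≤ 1 / 2 := decr_le (by norm_num) (meanTilde_le_half μ) k
  have hL : Real.log 2 ≤ Real.log ((k : ℝ) + 2) :=
    Real.log_le_log two_pos (by linarith [(Nat.cast_nonneg k : (0 : ℝ) ≤ k)])
  have hL0 : 0 ≤ Real.log ((k : ℝ) + 2) := (Real.log_nonneg one_le_two).trans hL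
  have h1 : meanTilde μ j * Real.log ((k : ℝ) + 2) ≤ s :=
    (mul_le_mul_of_nonneg_right hqj hL0).trans (mul_log_le_of_seqS hs0 hs k)
  have h2 : Real.log ((k : ℝ) + 2) ≤ t * Real.log (1 / meanTilde μ j) := by
    refine (log_le_of_seqT ht0 ht (hj'.trans_le hqj) (by linarith)).trans ?_
    have hq0 := hj'.trans_le hqj
    gcongr
  obtain ⟨l, hl, hle⟩ := exists_exponent hn hj' (meanTilde_le_half μ j) hL h1 h2
  refine (lintegral_excess_le μ hn' j hl a).trans ?_
  rw [← ENNReal.ofReal_mul hR0]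
  exact ENNReal.ofReal_le_ofReal hle

end LocalGC

theorem mainTheorem3 :
    ∃ c : ℝ, 0 < c ∧
      ∀ (μ : Measure (ℕ → Bool)) [IsProbabilityMeasure μ], LocalGC.T μ < ∞ →
        ∀ n : ℕ, Real.exp 3 ≤ (n : ℝ) →
          LocalGC.Delta n μ ≤
            ENNReal.ofReal c *
              ((LocalGC.S μ / (n : ℝ≥0∞)) ^ (1 / 2 : ℝ) +
                LocalGC.T μ * ENNReal.ofReal (Real.log n) / (n : ℝ≥0∞)) := by
  set K := ∑' k : ℕ, ENNReal.ofReal (Real.exp (-2 * Real.log ((k : ℝ) + 2))) with hK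
  have hKtop : K ≠ ∞ := LocalGC.tsum_exp_log_ne_top
  -- With `A = √(s/n)` and `B = t log n / n`, the total is `4 A + 6 B + 8 K (A + B)`.
  refine ⟨6 + 8 * K.toReal, by positivity, fun μ _ hT n hn => ?_⟩
  have hn0 : (0 : ℝ) < n := (Real.exp_pos 3).trans_le hn
  have hlog : 0 ≤ Real.log n := by linarith [(Real.le_log_iff_exp_le hn0).2 hn]
  have hc : 0 < 6 + 8 * K.toReal := by positivity
  by_cases hμ : Tendsto (LocalGC.meanTilde μ) atTop (𝓝 0)
  swap
  · simp [LocalGC.T, hμ] at hT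
  -- Finite `T` in fact forces `S` finite, but this is not needed: for `S = ∞` the bound is trivial.
  rcases eq_or_ne (LocalGC.S μ) ∞ with hS | hS
  · rw [hS, ENNReal.top_div_of_ne_top (ENNReal.natCast_ne_top n),
      ENNReal.top_rpow_of_pos (by norm_num), top_add,
      ENNReal.mul_top (ENNReal.ofReal_pos.2 hc).ne']
    exact le_top
  obtain ⟨s, hs0, hs⟩ : ∃ s, 0 ≤ s ∧ LocalGC.S μ = ENNReal.ofReal s :=
    ⟨_, ENNReal.toReal_nonneg, (ENNReal.ofReal_toReal hS).symm⟩
  obtain ⟨t, ht0, ht⟩ : ∃ t, 0 ≤ t ∧ LocalGC.T μ = ENNReal.ofReal t :=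
    ⟨_, ENNReal.toReal_nonneg, (ENNReal.ofReal_toReal hT.ne).symm⟩
  have hs' := hs
  have ht' := ht
  rw [LocalGC.S, if_pos hμ] at hs'
  rw [LocalGC.T, if_pos hμ] at ht'
  refine (LocalGC.Delta_le_of_decr μ hμ hn hs0 ht0 hs'.le ht'.le).trans ?_
  rw [hs, ht, ← ENNReal.ofReal_mul ht0, ← ENNReal.ofReal_natCast n,
    ← ENNReal.ofReal_div_of_pos hn0, ← ENNReal.ofReal_div_of_pos hn0,
    ENNReal.ofReal_rpow_of_nonneg (by positivity) (by norm_num), ← Real.sqrt_eq_rpow,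
    ← ENNReal.ofReal_add (by positivity) (by positivity), ← ENNReal.ofReal_mul hc.le, ← hK,
    ← ENNReal.ofReal_toReal hKtop, ← ENNReal.ofReal_mul (by positivity),
    ← ENNReal.ofReal_add (by positivity) (by positivity),
    ENNReal.toReal_ofReal ENNReal.toReal_nonneg]
  apply ENNReal.ofReal_le_ofReal
  have := Real.sqrt_nonneg (s / n)
  linarith
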